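/- For complex $a$, $q$ with $|q|<1$ and $m\ge 0$ put $(a;q)_m=\prod_{j=0}^{m-1}(1-aq^j)$, $(a;q)_\infty=\prod_{j=0}^{\infty}(1-aq^j)$ and $(a_1,a_2,a_3;q)_\infty=(a_1;q)_\infty(a_2;q)_\infty(a_3;q)_\infty$. Then for every complex $q$ with $|q|<1$ the following four identities hold (with $0^0=1$ when $q=0$), all the double series, over integers $n,r\ge 0$, being absolutely convergent: $$\sum_{n,r\ge 0}\frac{(-1)^{n+r}q^{6n^2+8nr+5r^2+4n+4r}}{(-q^2;q^2)_{2n+2r+1}(q^2;q^2)_r(-q;q)_{2r+1}(q^4;q^4)_n}=\frac{(q,q^8,q^9;q^9)_\infty}{(q^4;q^4)_\infty},$$ $$\sum_{n,r\ge 0}\frac{(-1)^{n+r}q^{6n^2+8nr+5r^2+4n+2r}}{(-q^2;q^2)_{2n+2r+1}(q^2;q^2)_r(-q;q)_{2r}(q^4;q^4)_n}=\frac{(q^2,q^7,q^9;q^9)_\infty}{(q^4;q^4)_\infty},$$ $$\sum_{n,r\ge 0}\frac{(-1)^{n+r}q^{6n^2+8nr+5r^2-2r}}{(-q^2;q^2)_{2n+2r}(q^2;q^2)_r(-q;q)_{2r}(q^4;q^4)_n}=\frac{(q^3;q^3)_\infty}{(q^4;q^4)_\infty},$$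 $$\sum_{n,r\ge 0}\frac{(-1)^{n+r}q^{6n^2+8nr+5r^2}}{(-q^2;q^2)_{2n+2r}(q^2;q^2)_r(-q;q)_{2r}(q^4;q^4)_n}=\frac{(q^4,q^5,q^9;q^9)_\infty}{(q^4;q^4)_\infty}.$$ -/

import Mathlib

/-- The finite `q`-shifted factorial `(a; q)_m = ∏_{j=0}^{m-1} (1 - a q^j)`. -/
noncomputable def qPoch (a q : ℂ) (m : ℕ) : ℂ :=
  ∏ j ∈ Finset.range m, (1 - a * q ^ j)

/-- The infinite `q`-shifted factorial `(a; q)_∞ = ∏_{j=0}^∞ (1 - a q^j)`, meaningful for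
`‖q‖ < 1`, where the product converges by `multipliable_qPochInf`. -/
noncomputable def qPochInf (a q : ℂ) : ℂ :=
  ∏' j : ℕ, (1 - a * q ^ j)

/-- `(a, b, c; q)_∞ = (a; q)_∞ (b; q)_∞ (c; q)_∞`. -/
noncomputable def qPochInf₃ (a b c q : ℂ) : ℂ :=
  qPochInf a q * qPochInf b q * qPochInf c q

/-- For `‖q‖ < 1` the infinite product defining `(a; q)_∞` converges. -/
theorem multipliable_qPochInf (a q : ℂ) (hq : ‖q‖ < 1) :
    Multipliable fun j : ℕ => 1 - a * q ^ j := by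
  have h : Summable fun j : ℕ => ‖-(a * q ^ j)‖ := by
    simpa [norm_mul, norm_pow] using
      (summable_geometric_of_lt_one (norm_nonneg q) hq).mul_left ‖a‖
  simpa [sub_eq_add_neg] using multipliable_one_add_of_summable h

open Filter Topology

/-! Fix s in {0, 1} and call `f`, `u` a pair in base q when Σ_k f(k) / ((q;q)_{n-k} (q;q)_{n+k+s}) =
u(n), the sum being over all integers k. The finite Jacobi triple product
(`hasSum_thetaTerm_mul_invQFac`) makes f(k) = (-1)^k q^{ek + k(k-1)/2} such a pair, with an explicit
product u(n) = `thetaPartner q e s n`. For e = 0 or e = -1 a factor of (q^e; q)_n vanishes, so u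
lives on {0} or {0, 1}.

Two changes of base, q → q² → q⁴ (`hasSum_base_change`), keep f and turn u into a single sum. The
Bailey lemma in base q⁴ (`hasSum_bailey`) then adds one more sum and multiplies f(k) by q^{4k² +
4sk}, which makes it the general term of a theta series in base q⁹ at q^t, t = e + 4s + 4. Letting
the outer index tend to infinity, with the Jacobi triple product on the theta side, gives the double
series. The choices (e, s) = (0,1), (-1,1), (-1,0), (0,0) give t = 8, 7, 3, 4, the four identities
in order. -/

/-! ### Shifted factorials: nonvanishing, limits, bounds -/

theorem qPoch_succ (a q : ℂ) (m : ℕ) : qPoch a q (m + 1) = qPoch a q m * (1 - a * q ^ m) :=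
  Finset.prod_range_succ _ _

theorem qPoch_zero (a q : ℂ) : qPoch a q 0 = 1 := Finset.prod_range_zero _

theorem one_sub_mul_pow_ne_zero {a q : ℂ} (ha : ‖a‖ < 1) (hq : ‖q‖ < 1) (j : ℕ) :
    1 - a * q ^ j ≠ 0 := by
  intro h
  have h1 : ‖a * q ^ j‖ = 1 := by rw [← sub_eq_zero.mp h, norm_one]
  rw [norm_mul, norm_pow] at h1
  nlinarith [pow_le_one₀ (norm_nonneg q) hq.le (n := j), norm_nonneg a,
    pow_nonneg (norm_nonneg q) j]

theorem qPoch_ne_zero {a q : ℂ} (ha : ‖a‖ < 1) (hq : ‖q‖ < 1) (m : ℕ) : qPoch a q m ≠ 0 :=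
  Finset.prod_ne_zero_iff.mpr fun j _ => one_sub_mul_pow_ne_zero ha hq j

theorem tendsto_qPoch (a : ℂ) {q : ℂ} (hq : ‖q‖ < 1) :
    Tendsto (qPoch a q) atTop (𝓝 (qPochInf a q)) :=
  (multipliable_qPochInf a q hq).hasProd.tendsto_prod_nat

theorem qPochInf_ne_zero {a q : ℂ} (ha : ‖a‖ < 1) (hq : ‖q‖ < 1) : qPochInf a q ≠ 0 := by
  have h : Summable fun j : ℕ => ‖-(a * q ^ j)‖ := by
    simpa [norm_mul, norm_pow] using
      (summable_geometric_of_lt_one (norm_nonneg q) hq).mul_left ‖a‖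
  have := tprod_one_add_ne_zero_of_summable (f := fun j : ℕ => -(a * q ^ j))
    (fun j => by simpa [sub_eq_add_neg] using one_sub_mul_pow_ne_zero ha hq j) h
  simpa [qPochInf, sub_eq_add_neg] using this

/-- The reciprocals converge because the infinite product is nonzero, hence are bounded. This
supplies the dominating constants for the limits below. -/
theorem exists_norm_inv_qPoch_le {a q : ℂ} (ha : ‖a‖ < 1) (hq : ‖q‖ < 1) :
    ∃ C : ℝ, 0 ≤ C ∧ ∀ m, ‖(qPoch a q m)⁻¹‖ ≤ C := by
  obtain ⟨C, hC⟩ := (((tendsto_qPoch a hq).inv₀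
    (qPochInf_ne_zero ha hq)).norm.bddAbove_range)
  have h : ∀ m, ‖(qPoch a q m)⁻¹‖ ≤ C := fun m => hC ⟨m, rfl⟩
  exact ⟨C, (norm_nonneg _).trans (h 0), h⟩

theorem norm_pow_lt_one {q : ℂ} (hq : ‖q‖ < 1) {n : ℕ} (hn : n ≠ 0) : ‖q ^ n‖ < 1 := by
  rw [norm_pow]; exact pow_lt_one₀ (norm_nonneg q) hq hn

/-! ### Reciprocal factorials on all integers -/

/-- `1 / (q; q)_n`, extended by zero to negative integers `n`. -/
noncomputable def invQFac (q : ℂ) (n : ℤ) : ℂ :=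
  if n < 0 then 0 else (qPoch q q n.toNat)⁻¹

theorem invQFac_of_neg (q : ℂ) {n : ℤ} (hn : n < 0) : invQFac q n = 0 := if_pos hn

theorem invQFac_natCast (q : ℂ) (n : ℕ) : invQFac q n = (qPoch q q n)⁻¹ := by
  simp [invQFac]

theorem invQFac_zero (q : ℂ) : invQFac q 0 = 1 := by
  simpa [qPoch_zero] using invQFac_natCast q 0

/-- Extension by zero is consistent at n = 0 because 1 - q^0 = 0, so the recurrence needs no case
split on n. It drives every telescoping argument below. -/
theorem invQFac_sub_one {q : ℂ} (hq : ‖q‖ < 1) (n : ℤ) :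
    invQFac q (n - 1) = (1 - q ^ n) * invQFac q n := by
  rcases lt_trichotomy n 0 with h | rfl | h
  · rw [invQFac_of_neg q h, invQFac_of_neg q (by lia), mul_zero]
  · rw [invQFac_of_neg q (by lia)]; simp
  · obtain ⟨m, rfl⟩ : ∃ m : ℕ, n = (m + 1 : ℕ) := ⟨(n - 1).toNat, by lia⟩
    have h1 := one_sub_mul_pow_ne_zero hq hq m
    have h2 := qPoch_ne_zero hq hq m
    rw [show ((m + 1 : ℕ) : ℤ) - 1 = (m : ℕ) by push_cast; ring, invQFac_natCast, invQFac_natCast,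
      qPoch_succ, zpow_natCast, pow_succ']
    field_simp

theorem exists_norm_invQFac_le {q : ℂ} (hq : ‖q‖ < 1) :
    ∃ C : ℝ, 0 ≤ C ∧ ∀ n, ‖invQFac q n‖ ≤ C := by
  obtain ⟨C, hC0, hC⟩ := exists_norm_inv_qPoch_le hq hq
  refine ⟨C, hC0, fun n => ?_⟩
  rw [invQFac]
  split_ifs
  · simpa using hC0
  · exact hC _

theorem tendsto_invQFac {q : ℂ} (hq : ‖q‖ < 1) {f : ℕ → ℤ} (hf : Tendsto f atTop atTop) :
    Tendsto (fun n => invQFac q (f n)) atTop (𝓝 (qPochInf q q)⁻¹) := by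
  have h : Tendsto (fun n => (f n).toNat) atTop atTop := by
    refine tendsto_atTop.mpr fun b => ?_
    filter_upwards [tendsto_atTop.mp hf b] with n hn
    lia
  refine (((tendsto_qPoch q hq).inv₀ (qPochInf_ne_zero hq hq)).comp h).congr' ?_
  filter_upwards [tendsto_atTop.mp hf 0] with n hn
  simp [invQFac, not_lt.mpr hn]

theorem qPoch_mul_qPoch_neg (q : ℂ) (n : ℕ) :
    qPoch q q n * qPoch (-q) q n = qPoch (q ^ 2) (q ^ 2) n := by
  simp only [qPoch, ← Finset.prod_mul_distrib]
  refine Finset.prod_congr rfl fun j _ => ?_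
  ring

theorem one_sub_pow_ne_zero {q : ℂ} (hq : ‖q‖ < 1) {n : ℕ} (hn : n ≠ 0) : 1 - q ^ n ≠ 0 := by
  simpa using one_sub_mul_pow_ne_zero (norm_pow_lt_one hq hn) hq 0

theorem qPoch_neg_succ (q : ℂ) (m : ℕ) :
    qPoch (-q) q (m + 1) = qPoch (-q) q m * (1 + q ^ (m + 1)) := by
  rw [qPoch_succ]; ring

/-! ### Finite summations behind the Bailey machinery -/

/-- The `q`-Chu–Vandermonde sum behind the change of base `q → q²` for Bailey pairs. -/
theorem sum_base_change {q : ℂ} (hq : ‖q‖ < 1) (hq0 : q ≠ 0) (M N T : ℕ) (h : min M N ≤ T) :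
    ∑ j ∈ Finset.range (T + 1), (-1 : ℂ) ^ j * q ^ (j ^ 2) * invQFac (q ^ 2) j
        * (invQFac q (M - j) * invQFac q (N - j))
      = qPoch (-q) q (M + N) * (invQFac (q ^ 2) M * invQFac (q ^ 2) N) := by
  have hq2 : ‖q ^ 2‖ < 1 := norm_pow_lt_one hq two_ne_zero
  induction M with
  | zero =>
    rw [Finset.sum_eq_single 0]
    · have h1 := qPoch_ne_zero hq hq N
      have h2 : qPoch (-q) q N ≠ 0 := qPoch_ne_zero (by simpa using hq) hq N
      simp only [Nat.cast_zero, sub_zero, invQFac_zero, invQFac_natCast, ← qPoch_mul_qPoch_neg,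
        zero_add]
      field_simp
      simp
    · intro j _ hj
      rw [invQFac_of_neg q (n := ((0 : ℕ) : ℤ) - j) (by lia)]
      simp
    · simp
  | succ M ih =>
    specialize ih (by lia)
    have hne : 1 - q ^ (2 * (M + 1)) ≠ 0 := one_sub_pow_ne_zero hq (by lia)
    -- Both sides should satisfy (1 - q^{2(M+1)}) S(M+1) = (1 + q^{M+N+1}) S(M). For the sum this is
    -- creative telescoping with certificate G, whose boundary values vanish through reciprocal
    -- factorials at negative integers.
    obtain ⟨G, tel, hG0, hGT⟩ : ∃ G : ℕ → ℂ, (∀ j : ℕ,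
        (1 - q ^ (2 * (M + 1))) * ((-1 : ℂ) ^ j * q ^ (j ^ 2) * invQFac (q ^ 2) j
          * (invQFac q ((M + 1 : ℕ) - j) * invQFac q (N - j)))
        - (1 + q ^ (M + 1 + N)) * ((-1 : ℂ) ^ j * q ^ (j ^ 2) * invQFac (q ^ 2) j
          * (invQFac q (M - j) * invQFac q (N - j))) = G (j + 1) - G j)
        ∧ G 0 = 0 ∧ G (T + 1) = 0 := by
      refine ⟨fun j => -((-1 : ℂ) ^ j * q ^ ((M + 1 : ℤ) - j) * q ^ (j ^ 2)
        * invQFac (q ^ 2) (j - 1) * (invQFac q (M + 1 - j) * invQFac q (N - j))),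
        fun j => ?_, ?_, ?_⟩
      · have e1 : invQFac q ((M : ℤ) - j)
            = (1 - q ^ ((M + 1 : ℤ) - j)) * invQFac q (M + 1 - j) := by
          rw [← invQFac_sub_one hq]; congr 1; ring
        have e2 : invQFac q ((N : ℤ) - (j + 1)) = (1 - q ^ ((N : ℤ) - j)) * invQFac q (N - j) := by
          rw [← invQFac_sub_one hq]; congr 1; ring
        simp only [Nat.cast_add, Nat.cast_one, add_sub_cancel_right,
          show (M + 1 : ℤ) - (j + 1) = M - j by ring]
        rw [e2, e1, invQFac_sub_one hq2]
        simp only [zpow_sub₀ hq0, zpow_add₀ hq0, zpow_natCast, zpow_one]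
        field_simp
        ring
      · simp [invQFac_of_neg (q ^ 2) (n := -1) (by lia)]
      · rcases min_le_iff.mp h with h | h
        · simp [invQFac_of_neg q (n := (M : ℤ) - T) (by lia)]
        · simp [invQFac_of_neg q (n := (N : ℤ) - (T + 1)) (by lia)]
    have hsum := Finset.sum_congr (rfl : Finset.range (T + 1) = _) fun j _ => tel j
    rw [Finset.sum_range_sub, Finset.sum_sub_distrib, ← Finset.mul_sum, ← Finset.mul_sum, ih,
      hG0, hGT] at hsum
    refine mul_left_cancel₀ hne ?_
    have e3 : invQFac (q ^ 2) M = (1 - q ^ (2 * (M + 1))) * invQFac (q ^ 2) (M + 1 : ℕ) := by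
      rw [pow_mul, ← zpow_natCast (q ^ 2), ← invQFac_sub_one hq2]; congr 1; push_cast; ring
    rw [e3] at hsum
    rw [show M + 1 + N = (M + N) + 1 by ring] at hsum ⊢
    rw [qPoch_neg_succ]
    linear_combination hsum

/-- The finite form of the Bailey lemma, as a sum over the outer index. -/
theorem sum_bailey {q : ℂ} (hq : ‖q‖ < 1) (hq0 : q ≠ 0) (s : ℕ) (hs : s ≤ 1) (N : ℕ) (k : ℤ) :
    ∑ L ∈ Finset.range (N + 1), q ^ (L ^ 2 + s * L) * invQFac q (N - L)
        * (invQFac q (L - k) * invQFac q (L + k + s))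
      = q ^ (k ^ 2 + s * k) * (invQFac q (N - k) * invQFac q (N + k + s)) := by
  -- The symmetry k ↦ -k - s swaps the two factors; s ≤ 1 ensures that it sends negative k to
  -- nonnegative k.
  wlog hk : 0 ≤ k generalizing k
  · have := this (-k - s) (by lia)
    convert this using 1
    · refine Finset.sum_congr rfl fun L _ => ?_
      rw [show (L : ℤ) - (-k - s) = L + k + s by ring, show (L : ℤ) + (-k - s) + s = L - k by ring]
      ring
    · rw [show (N : ℤ) - (-k - s) = N + k + s by ring, show (N : ℤ) + (-k - s) + s = N - k by ring,
        show (-k - s : ℤ) ^ 2 + s * (-k - s) = k ^ 2 + s * k by ring]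
      ring
  have single : ∀ N : ℕ, (N : ℤ) ≤ k →
      ∑ L ∈ Finset.range (N + 1), q ^ (L ^ 2 + s * L) * invQFac q (N - L)
        * (invQFac q (L - k) * invQFac q (L + k + s))
      = q ^ (k ^ 2 + s * k) * (invQFac q (N - k) * invQFac q (N + k + s)) := by
    intro N hN
    rw [Finset.sum_range_succ, Finset.sum_eq_zero]
    · rcases hN.lt_or_eq with h | h
      · rw [invQFac_of_neg q (n := (N : ℤ) - k) (by lia)]; ring
      · subst h
        rw [sub_self, invQFac_zero, ← zpow_natCast]; push_cast; ring
    · intro L hL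
      rw [invQFac_of_neg q (n := (L : ℤ) - k) (by have := Finset.mem_range.mp hL; lia)]; ring
  induction N with
  | zero => exact single 0 (by simpa using hk)
  | succ N ih =>
    rcases le_or_gt ((N + 1 : ℕ) : ℤ) k with h | h
    · exact single _ h
    obtain ⟨k, rfl⟩ := Int.eq_ofNat_of_zero_le hk
    obtain ⟨d, rfl⟩ : ∃ d, N = k + d := ⟨N - k, by lia⟩
    have ne1 : 1 - q ^ (d + 1) ≠ 0 := one_sub_pow_ne_zero hq (by lia)
    have ne2 : 1 - q ^ (2 * k + d + 1 + s) ≠ 0 := one_sub_pow_ne_zero hq (by lia)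
    -- Telescoping again, now for (1 - q^{N+1-k})(1 - q^{N+1+k+s}) S(N+1) = S(N) with N = k + d.
    -- Summing S(N) up to L = N + 1 is harmless, since the extra term is zero.
    obtain ⟨G, tel, hG0, hGT⟩ : ∃ G : ℕ → ℂ, (∀ L : ℕ,
        ((1 - q ^ (d + 1)) * (1 - q ^ (2 * k + d + 1 + s))) * (q ^ (L ^ 2 + s * L)
          * invQFac q ((k + d + 1 : ℕ) - L) * (invQFac q (L - k) * invQFac q (L + k + s)))
        - q ^ (L ^ 2 + s * L) * invQFac q ((k + d : ℕ) - L)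
          * (invQFac q (L - k) * invQFac q (L + k + s)) = G (L + 1) - G L)
        ∧ G 0 = 0 ∧ G (k + d + 1 + 1) = 0 := by
      refine ⟨fun L => -(q ^ ((k + d + 1 : ℤ) - L) * q ^ (L ^ 2 + s * L)
        * invQFac q (k + d + 1 - L) * (invQFac q (L - k - 1) * invQFac q (L + k + s - 1))),
        fun L => ?_, ?_, ?_⟩
      · have e1 : invQFac q ((k + d : ℤ) - L)
            = (1 - q ^ ((k + d + 1 : ℤ) - L)) * invQFac q (k + d + 1 - L) := by
          rw [← invQFac_sub_one hq]; congr 1; ring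
        simp only [Nat.cast_add, Nat.cast_one,
          show (k + d + 1 : ℤ) - (L + 1) = k + d - L by ring,
          show (L + 1 : ℤ) - k - 1 = L - k by ring,
          show (L + 1 : ℤ) + k + s - 1 = L + k + s by ring]
        rw [e1, invQFac_sub_one hq, invQFac_sub_one hq]
        simp only [zpow_sub₀ hq0, zpow_add₀ hq0, zpow_natCast, zpow_one]
        field_simp
        ring
      · simp [invQFac_of_neg q (n := -(k : ℤ) - 1) (by lia)]
      · simp [invQFac_of_neg q (n := -1) (by lia)]
    have hsum := Finset.sum_congr (rfl : Finset.range (k + d + 1 + 1) = _) fun j _ => tel j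
    rw [Finset.sum_range_sub, Finset.sum_sub_distrib, ← Finset.mul_sum,
      Finset.sum_range_succ (n := k + d + 1) (f := fun L : ℕ => q ^ (L ^ 2 + s * L)
        * invQFac q ((k + d : ℕ) - L) * (invQFac q (L - (k : ℤ)) * invQFac q (L + k + s))),
      ih, invQFac_of_neg q (n := ((k + d : ℕ) : ℤ) - (k + d + 1 : ℕ)) (by lia), hG0, hGT] at hsum
    refine mul_left_cancel₀ (mul_ne_zero ne1 ne2) ?_
    have e1 : invQFac q ((k + d : ℕ) - k) = (1 - q ^ (d + 1)) * invQFac q ((k + d + 1 : ℕ) - k) := by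
      rw [← zpow_natCast q, show ((d + 1 : ℕ) : ℤ) = (k + d + 1 : ℕ) - k by push_cast; ring,
        ← invQFac_sub_one hq]; congr 1; push_cast; ring
    have e2 : invQFac q ((k + d : ℕ) + k + s)
        = (1 - q ^ (2 * k + d + 1 + s)) * invQFac q ((k + d + 1 : ℕ) + k + s) := by
      rw [← zpow_natCast q, show ((2 * k + d + 1 + s : ℕ) : ℤ) = (k + d + 1 : ℕ) + k + s by
        push_cast; ring, ← invQFac_sub_one hq]; congr 1; push_cast; ring
    rw [e1, e2] at hsum
    linear_combination hsum

/-! ### Theta series and the Jacobi triple product -/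

/-- The general term `(-1)^k z^k q^{k(k-1)/2}` of a theta series. -/
noncomputable def thetaTerm (z q : ℂ) (k : ℤ) : ℂ := (-z) ^ k * q ^ (k * (k - 1) / 2)

theorem two_mul_mul_pred_ediv_two (k : ℤ) : 2 * (k * (k - 1) / 2) = k * (k - 1) :=
  Int.mul_ediv_cancel' (even_iff_two_dvd.mp (Int.even_mul_pred_self k))

theorem thetaTerm_add_one {z q : ℂ} (hz : z ≠ 0) (hq0 : q ≠ 0) (k : ℤ) :
    thetaTerm z q (k + 1) = -z * q ^ k * thetaTerm z q k := by
  have h : (k + 1) * (k + 1 - 1) / 2 = k * (k - 1) / 2 + k := by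
    have h1 := two_mul_mul_pred_ediv_two k
    have h2 := two_mul_mul_pred_ediv_two (k + 1)
    linarith
  rw [thetaTerm, thetaTerm, h, zpow_add₀ hq0, zpow_add₀ (neg_ne_zero.mpr hz), zpow_one]
  ring

theorem HasSum.of_eq {ι : Type*} {f g : ι → ℂ} {a b : ℂ} (h : HasSum g b) (hf : ∀ k, f k = g k)
    (hab : a = b) : HasSum f a := by
  rw [hab, funext hf]; exact h

/-- The finite form of the Jacobi triple product. -/
theorem hasSum_thetaTerm_mul_invQFac {q z : ℂ} (hq : ‖q‖ < 1) (hq0 : q ≠ 0) (hz : z ≠ 0)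
    (A B : ℕ) :
    HasSum (fun k : ℤ => thetaTerm z q k * (invQFac q (A - k) * invQFac q (B + k)))
      (qPoch z q A * qPoch (q / z) q B * invQFac q (A + B)) := by
  have hne : ∀ n : ℕ, 1 - q ^ (n + 1) ≠ 0 := fun n => one_sub_pow_ne_zero hq n.succ_ne_zero
  have hstep : ∀ n : ℕ, invQFac q n = (1 - q ^ (n + 1)) * invQFac q (n + 1 : ℕ) := fun n => by
    have := invQFac_sub_one hq (n + 1)
    rwa [add_sub_cancel_right, show (n + 1 : ℤ) = (n + 1 : ℕ) by norm_cast, zpow_natCast] at this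
  induction A with
  | zero =>
    induction B with
    | zero =>
      convert hasSum_single (0 : ℤ) fun k hk => ?_ using 1
      · simp [qPoch_zero, invQFac_zero, thetaTerm]
      · rcases hk.lt_or_gt with h | h
        · rw [invQFac_of_neg q (n := ((0 : ℕ) : ℤ) + k) (by simpa using h)]; simp
        · rw [invQFac_of_neg q (n := ((0 : ℕ) : ℤ) - k) (by simpa using h)]; simp
    | succ B ih =>
      -- Adding a multiple of the series shifted by one in k produces the new factor 1 - (q/z) q^B;
      -- the step in A below uses the opposite shift to produce 1 - z q^A.
      have h2 := ((Equiv.addRight (1 : ℤ)).hasSum_iff.mpr ih).mul_left (-(q ^ (B + 1) / z))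
      refine ((ih.add h2).mul_left (1 - q ^ (B + 1))⁻¹).of_eq (fun k => ?_) ?_
      · have e1 : invQFac q (B + k) = (1 - q ^ (B + 1 + k : ℤ)) * invQFac q (B + 1 + k) := by
          rw [← invQFac_sub_one hq]; congr 1; ring
        have e2 : invQFac q (-(k + 1)) = (1 - q ^ (-k)) * invQFac q (-k) := by
          rw [← invQFac_sub_one hq]; congr 1; ring
        simp only [Equiv.coe_addRight, Function.comp_apply, Nat.cast_zero, zero_sub, Nat.cast_add,
          Nat.cast_one, thetaTerm_add_one hz hq0]
        rw [show (B + (k + 1) : ℤ) = B + 1 + k by ring, e1, e2, eq_inv_mul_iff_mul_eq₀ (hne B)]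
        simp only [zpow_neg, zpow_add₀ hq0, zpow_natCast, zpow_one]
        have := zpow_ne_zero k hq0
        field_simp
        ring
      · rw [eq_inv_mul_iff_mul_eq₀ (hne B), qPoch_succ]
        simp only [Nat.cast_zero, zero_add, hstep B]
        ring
  | succ A ih =>
    have h2 := ((Equiv.subRight (1 : ℤ)).hasSum_iff.mpr ih).mul_left (-(z * q ^ A))
    refine ((ih.add h2).mul_left (1 - q ^ (A + B + 1))⁻¹).of_eq (fun k => ?_) ?_
    · obtain ⟨k, rfl⟩ : ∃ l, k = l + 1 := ⟨k - 1, by ring⟩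
      have e1 : invQFac q (A - (k + 1)) = (1 - q ^ (A - k : ℤ)) * invQFac q (A - k) := by
        rw [← invQFac_sub_one hq]; congr 1; ring
      have e2 : invQFac q (B + k) = (1 - q ^ (B + k + 1 : ℤ)) * invQFac q (B + (k + 1)) := by
        rw [add_assoc, ← invQFac_sub_one hq]; congr 1; ring
      simp only [Equiv.subRight_apply, Function.comp_apply, Nat.cast_add, add_sub_cancel_right,
        Nat.cast_one, thetaTerm_add_one hz hq0]
      rw [show (A + 1 - (k + 1) : ℤ) = A - k by ring, e1, e2,
        eq_inv_mul_iff_mul_eq₀ (hne (A + B))]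
      simp only [zpow_sub₀ hq0, zpow_add₀ hq0, zpow_natCast, zpow_one]
      have := zpow_ne_zero k hq0
      field_simp
      ring
    · rw [eq_inv_mul_iff_mul_eq₀ (hne (A + B)), qPoch_succ]
      rw [← Nat.cast_add, ← Nat.cast_add, hstep (A + B), add_right_comm A 1 B]
      ring

/-- Dominated convergence: both reciprocal factorials are bounded uniformly in N and k, and each
tends to 1/(q;q)_∞ for fixed k. -/
theorem tendsto_tsum_mul_invQFac {q : ℂ} (hq : ‖q‖ < 1) (s : ℕ) {g : ℤ → ℂ}
    (hg : Summable fun k => ‖g k‖) :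
    Tendsto (fun N : ℕ => ∑' k, g k * (invQFac q (N - k) * invQFac q (N + k + s))) atTop
      (𝓝 ((∑' k, g k) * ((qPochInf q q)⁻¹ * (qPochInf q q)⁻¹))) := by
  obtain ⟨C, hC0, hC⟩ := exists_norm_invQFac_le hq
  rw [← tsum_mul_right]
  refine tendsto_tsum_of_dominated_convergence (bound := fun k => ‖g k‖ * (C * C))
    (hg.mul_right _) (fun k => ?_) (Eventually.of_forall fun N k => ?_)
  · refine tendsto_const_nhds.mul ((tendsto_invQFac hq ?_).mul (tendsto_invQFac hq ?_))
    · exact tendsto_atTop_add_const_right _ (-k) tendsto_natCast_atTop_atTop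
    · simp_rw [add_assoc]
      exact tendsto_atTop_add_const_right _ _ tendsto_natCast_atTop_atTop
  · rw [norm_mul, norm_mul]
    exact mul_le_mul_of_nonneg_left (mul_le_mul (hC _) (hC _) (norm_nonneg _) hC0) (norm_nonneg _)

/-- The Jacobi triple product. -/
theorem tsum_thetaTerm {q z : ℂ} (hq : ‖q‖ < 1) (hq0 : q ≠ 0) (hz : z ≠ 0)
    (hs : Summable fun k => ‖thetaTerm z q k‖) :
    ∑' k, thetaTerm z q k = qPochInf₃ z (q / z) q q := by
  have h1 := tendsto_tsum_mul_invQFac hq 0 hs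
  have h2 : Tendsto (fun N : ℕ => qPoch z q N * qPoch (q / z) q N * invQFac q (N + N)) atTop
      (𝓝 (qPochInf z q * qPochInf (q / z) q * (qPochInf q q)⁻¹)) :=
    ((tendsto_qPoch z hq).mul (tendsto_qPoch _ hq)).mul <| tendsto_invQFac hq <|
      tendsto_natCast_atTop_atTop.atTop_add_atTop tendsto_natCast_atTop_atTop
  have h := tendsto_nhds_unique h1 <| h2.congr fun N => by
    simpa using (hasSum_thetaTerm_mul_invQFac hq hq0 hz N N).tsum_eq.symm
  have hne := qPochInf_ne_zero hq hq
  rw [qPochInf₃]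
  field_simp at h
  linear_combination h

/-! ### Bailey pairs and passage to the limit -/

/-- Change of base `q → q²` in a Bailey pair. -/
theorem hasSum_base_change {q : ℂ} (hq : ‖q‖ < 1) (hq0 : q ≠ 0) (s : ℕ) (hs : s ≤ 1) {f : ℤ → ℂ} {u : ℕ → ℂ}
    (hu : ∀ n : ℕ, HasSum (fun k : ℤ => f k * (invQFac q (n - k) * invQFac q (n + k + s))) (u n))
    (n : ℕ) :
    HasSum (fun k : ℤ => f k * (invQFac (q ^ 2) (n - k) * invQFac (q ^ 2) (n + k + s)))
      ((qPoch (-q) q (2 * n + s))⁻¹ * ∑ p ∈ Finset.HasAntidiagonal.antidiagonal n,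
        (-1) ^ p.1 * q ^ (p.1 ^ 2) * invQFac (q ^ 2) p.1 * u p.2) := by
  rw [Finset.Nat.sum_antidiagonal_eq_sum_range_succ
    (fun i j => (-1) ^ i * q ^ (i ^ 2) * invQFac (q ^ 2) i * u j)]
  have hne : qPoch (-q) q (2 * n + s) ≠ 0 := qPoch_ne_zero (by simpa using hq) hq _
  refine ((hasSum_sum (s := Finset.range n.succ) fun j _ => (hu (n - j)).mul_left
    ((-1) ^ j * q ^ (j ^ 2) * invQFac (q ^ 2) j)).mul_left
      (qPoch (-q) q (2 * n + s))⁻¹).of_eq (fun k => ?_) rfl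
  rw [eq_inv_mul_iff_mul_eq₀ hne]
  have key : ∑ j ∈ Finset.range (n + 1), (-1 : ℂ) ^ j * q ^ (j ^ 2) * invQFac (q ^ 2) j
        * (invQFac q ((n - k) - j) * invQFac q ((n + k + s) - j))
      = qPoch (-q) q (2 * n + s) * (invQFac (q ^ 2) (n - k) * invQFac (q ^ 2) (n + k + s)) := by
    rcases lt_or_ge (n - k : ℤ) 0 with h | h
    · rw [invQFac_of_neg _ h, Finset.sum_eq_zero]
      · ring
      · intro j _
        rw [invQFac_of_neg q (n := n - k - j) (by lia)]; ring
    rcases lt_or_ge (n + k + s : ℤ) 0 with h' | h'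
    · rw [invQFac_of_neg _ h', Finset.sum_eq_zero]
      · ring
      · intro j _
        rw [invQFac_of_neg q (n := n + k + s - j) (by lia)]; ring
    obtain ⟨M, hM⟩ := Int.eq_ofNat_of_zero_le h
    obtain ⟨N, hN⟩ := Int.eq_ofNat_of_zero_le h'
    rw [hM, hN, show 2 * n + s = M + N by lia]
    -- The cutoff n suffices because min(n - k, n + k + s) ≤ n for every integer k, which is where s
    -- ≤ 1 enters.
    exact sum_base_change hq hq0 M N n (by lia)
  rw [mul_left_comm, ← key, Finset.mul_sum]
  refine Finset.sum_congr rfl fun j hj => ?_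
  rw [Nat.cast_sub (by simpa [Nat.lt_succ_iff] using hj), show (n - j - k : ℤ) = n - k - j by ring,
    show (n - j + k + s : ℤ) = n + k + s - j by ring]
  ring

/-- The finite Bailey lemma. -/
theorem hasSum_bailey {q : ℂ} (hq : ‖q‖ < 1) (hq0 : q ≠ 0) (s : ℕ) (hs : s ≤ 1) {f : ℤ → ℂ}
    {w : ℕ → ℂ}
    (hw : ∀ n : ℕ, HasSum (fun k : ℤ => f k * (invQFac q (n - k) * invQFac q (n + k + s))) (w n))
    (N : ℕ) :
    HasSum (fun k : ℤ => f k * q ^ (k ^ 2 + s * k)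
        * (invQFac q (N - k) * invQFac q (N + k + s)))
      (∑ L ∈ Finset.range (N + 1), q ^ (L ^ 2 + s * L) * invQFac q (N - L) * w L) := by
  refine (hasSum_sum (s := Finset.range (N + 1)) fun L _ => (hw L).mul_left
    (q ^ (L ^ 2 + s * L) * invQFac q (N - L))).of_eq (fun k => ?_) rfl
  rw [mul_assoc, ← sum_bailey hq hq0 s hs, Finset.mul_sum]
  refine Finset.sum_congr rfl fun L _ => ?_
  ring

/-- The factor `invQFac q (N - (p.1 + p.2))` vanishes beyond the triangle, so the truncated double
sum is a full series depending on N only through that factor, ready for dominated convergence. -/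
theorem sum_antidiagonal_eq_tsum (q : ℂ) (F : ℕ × ℕ → ℂ) (N : ℕ) :
    ∑ L ∈ Finset.range (N + 1), invQFac q (N - L) *
        ∑ p ∈ Finset.HasAntidiagonal.antidiagonal L, F p
      = ∑' p : ℕ × ℕ, F p * invQFac q (N - (p.1 + p.2 : ℕ)) := by
  rw [tsum_eq_sum (s := (Finset.range (N + 1) ×ˢ Finset.range (N + 1)).filter
    fun p => p.1 + p.2 ≤ N), ← Finset.sum_fiberwise_of_maps_to (t := Finset.range (N + 1))
    (g := fun p : ℕ × ℕ => p.1 + p.2)]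
  · refine Finset.sum_congr rfl fun L hL => ?_
    rw [Finset.mul_sum]
    refine Finset.sum_congr ?_ fun p hp => ?_
    · ext p
      simp only [Finset.mem_range, Finset.HasAntidiagonal.mem_antidiagonal, Finset.mem_filter,
        Finset.mem_product] at hL ⊢
      lia
    · rw [← (Finset.mem_filter.mp hp).2, mul_comm]
  · intro p hp
    simp only [Finset.mem_range, Finset.mem_filter] at hp ⊢
    lia
  · intro p hp
    simp only [Finset.mem_range, Finset.mem_filter, Finset.mem_product] at hp
    rw [invQFac_of_neg q (by lia), mul_zero]

/-- One change of base from q² to q⁴, then the Bailey lemma. As N → ∞ one side tends to ΣF /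
(q⁴;q⁴)_∞ and the other to theta / (q⁴;q⁴)_∞², so a single factor remains in the denominator. The
bound on `v` makes F absolutely summable. -/
theorem hasSum_double_of_bailey {q ζ : ℂ} (hq : ‖q‖ < 1) (hq0 : q ≠ 0) (hζ : ζ ≠ 0) {s : ℕ}
    (hs : s ≤ 1) {f : ℤ → ℂ} {v : ℕ → ℂ}
    (hv : ∀ n : ℕ, HasSum (fun k : ℤ =>
      f k * (invQFac (q ^ 2) (n - k) * invQFac (q ^ 2) (n + k + s))) (v n))
    {C : ℝ} (hC : ∀ n, ‖v n‖ ≤ C)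
    (hf : ∀ k, f k * (q ^ 4) ^ (k ^ 2 + s * k) = thetaTerm ζ (q ^ 9) k)
    (hθ : Summable fun k => ‖thetaTerm ζ (q ^ 9) k‖) :
    HasSum (fun p : ℕ × ℕ => (q ^ 4) ^ ((p.1 + p.2) ^ 2 + s * (p.1 + p.2))
        * (qPoch (-q ^ 2) (q ^ 2) (2 * (p.1 + p.2) + s))⁻¹
        * ((-1) ^ p.1 * (q ^ 2) ^ (p.1 ^ 2) * invQFac (q ^ 4) p.1 * v p.2))
      (qPochInf₃ ζ (q ^ 9 / ζ) (q ^ 9) (q ^ 9) / qPochInf (q ^ 4) (q ^ 4)) := by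
  have hq2 : ‖q ^ 2‖ < 1 := norm_pow_lt_one hq (by lia)
  have hq4 : ‖q ^ 4‖ < 1 := norm_pow_lt_one hq (by lia)
  have hq9 : ‖q ^ 9‖ < 1 := norm_pow_lt_one hq (by lia)
  set F : ℕ × ℕ → ℂ := fun p => (q ^ 4) ^ ((p.1 + p.2) ^ 2 + s * (p.1 + p.2))
        * (qPoch (-q ^ 2) (q ^ 2) (2 * (p.1 + p.2) + s))⁻¹
        * ((-1) ^ p.1 * (q ^ 2) ^ (p.1 ^ 2) * invQFac (q ^ 4) p.1 * v p.2) with hF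
  obtain ⟨C₁, hC₁0, hC₁⟩ := exists_norm_inv_qPoch_le (a := -q ^ 2) (by simpa using hq2) hq2
  obtain ⟨C₂, hC₂0, hC₂⟩ := exists_norm_invQFac_le hq4
  have hC0 : 0 ≤ C := (norm_nonneg _).trans (hC 0)
  have hFle : ∀ p, ‖F p‖ ≤ ‖q‖ ^ p.1 * ‖q‖ ^ p.2 * (C₁ * (C₂ * C)) := by
    intro p
    have h1 : ‖(q ^ 4) ^ ((p.1 + p.2) ^ 2 + s * (p.1 + p.2))‖ ≤ ‖q‖ ^ p.1 * ‖q‖ ^ p.2 := by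
      rw [← pow_mul, norm_pow, ← pow_add]
      refine pow_le_pow_of_le_one (norm_nonneg q) hq.le ?_
      nlinarith [Nat.le_self_pow two_ne_zero (p.1 + p.2), Nat.zero_le (s * (p.1 + p.2))]
    have h2 : ‖(-1 : ℂ) ^ p.1 * (q ^ 2) ^ (p.1 ^ 2)‖ ≤ 1 := by
      rw [norm_mul, norm_pow, norm_pow, norm_neg, norm_one, one_pow, one_mul]
      exact pow_le_one₀ (norm_nonneg _) hq2.le
    have h3 : ‖(-1 : ℂ) ^ p.1 * (q ^ 2) ^ (p.1 ^ 2) * invQFac (q ^ 4) p.1 * v p.2‖ ≤ C₂ * C := by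
      rw [norm_mul, norm_mul]
      refine mul_le_mul ?_ (hC _) (norm_nonneg _) hC₂0
      exact (mul_le_mul h2 (hC₂ _) (norm_nonneg _) zero_le_one).trans_eq (one_mul _)
    rw [hF, norm_mul, norm_mul, mul_assoc]
    exact mul_le_mul h1 (mul_le_mul (hC₁ _) h3 (norm_nonneg _) hC₁0) (by positivity)
      (by positivity)
  have hFs : Summable fun p => ‖F p‖ := by
    have h := summable_geometric_of_lt_one (norm_nonneg q) hq
    refine Summable.of_nonneg_of_le (fun _ => norm_nonneg _) hFle (Summable.mul_right _ ?_)
    exact h.mul_of_nonneg h (fun _ => by positivity) (fun _ => by positivity)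
  have h4 : (q ^ 2) ^ 2 = q ^ 4 := by ring
  have hw := hasSum_base_change hq2 (pow_ne_zero 2 hq0) s hs hv
  rw [h4] at hw
  have hX := hasSum_bailey hq4 (pow_ne_zero 4 hq0) s hs hw
  simp_rw [hf] at hX
  have key : ∀ N : ℕ, ∑' p : ℕ × ℕ, F p * invQFac (q ^ 4) (N - (p.1 + p.2 : ℕ))
      = ∑' k, thetaTerm ζ (q ^ 9) k
        * (invQFac (q ^ 4) (N - k) * invQFac (q ^ 4) (N + k + s)) := by
    intro N
    rw [(hX N).tsum_eq, ← sum_antidiagonal_eq_tsum]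
    refine Finset.sum_congr rfl fun L _ => ?_
    simp only [Finset.mul_sum]
    refine Finset.sum_congr rfl fun p hp => ?_
    have hp' : p.1 + p.2 = L := Finset.HasAntidiagonal.mem_antidiagonal.mp hp
    rw [← hp', hF]
    ring
  have hL : Tendsto (fun N : ℕ => ∑' p : ℕ × ℕ, F p * invQFac (q ^ 4) (N - (p.1 + p.2 : ℕ)))
      atTop (𝓝 ((∑' p, F p) * (qPochInf (q ^ 4) (q ^ 4))⁻¹)) := by
    rw [← tsum_mul_right]
    refine tendsto_tsum_of_dominated_convergence (bound := fun p => ‖F p‖ * C₂)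
      (hFs.mul_right _) (fun p => ?_) (Eventually.of_forall fun N p => ?_)
    · exact tendsto_const_nhds.mul (tendsto_invQFac hq4
        (tendsto_atTop_add_const_right _ _ tendsto_natCast_atTop_atTop))
    · rw [norm_mul]
      exact mul_le_mul_of_nonneg_left (hC₂ _) (norm_nonneg _)
  have h := tendsto_nhds_unique (hL.congr key) (tendsto_tsum_mul_invQFac hq4 s hθ)
  rw [tsum_thetaTerm hq9 (pow_ne_zero 9 hq0) hζ hθ] at h
  have hne := qPochInf_ne_zero hq4 hq4
  have h' : ∑' p, F p = qPochInf₃ ζ (q ^ 9 / ζ) (q ^ 9) (q ^ 9) / qPochInf (q ^ 4) (q ^ 4) := by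
    field_simp at h ⊢
    exact h
  exact h' ▸ hFs.of_norm.hasSum

/-! ### From theta series in base q to base q⁹ -/

/-- The exponent tk + 9k(k-1)/2 is at least |k|; k = 1 needs t ≥ 1 and k = -1 needs t ≤ 8. -/
theorem summable_norm_thetaTerm_pow {q : ℂ} (hq : ‖q‖ < 1) (hq0 : q ≠ 0) {t : ℕ} (ht1 : 1 ≤ t)
    (ht8 : t ≤ 8) : Summable fun k => ‖thetaTerm (q ^ t) (q ^ 9) k‖ := by
  have hgeo := summable_geometric_of_lt_one (norm_nonneg q) hq
  have hsum : Summable fun k : ℤ => ‖q‖ ^ k.natAbs :=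
    Summable.of_nat_of_neg (by simpa using hgeo) (by simpa using hgeo)
  refine Summable.of_nonneg_of_le (fun _ => norm_nonneg _) (fun k => ?_) hsum
  rw [thetaTerm, norm_mul, norm_zpow, norm_zpow, norm_neg, norm_pow, norm_pow, ← zpow_natCast,
    ← zpow_natCast, ← zpow_natCast, ← zpow_mul, ← zpow_mul, ← zpow_add₀ (norm_ne_zero_iff.mpr hq0)]
  refine zpow_le_zpow_right_of_le_one₀ (norm_pos_iff.mpr hq0) hq.le ?_
  have h := two_mul_mul_pred_ediv_two k
  set T := k * (k - 1) / 2
  push_cast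
  rcases le_or_gt 1 k with hk | hk
  · rw [abs_of_nonneg (by lia)]
    nlinarith
  · rw [abs_of_nonpos (by lia)]
    have h1 : 0 ≤ k * (k + 1) := by
      rcases eq_or_lt_of_le (show k ≤ 0 by lia) with rfl | hk
      · simp
      · exact mul_nonneg_of_nonpos_of_nonpos hk.le (by lia)
    nlinarith [mul_nonneg (show (0 : ℤ) ≤ 8 - t by lia) (show 0 ≤ -k by lia)]

/-- Since 4k² + 4sk = 8·k(k-1)/2 + (4s + 4)k, the Gaussian factor raises the base from q to q⁹ and
shifts the linear exponent by 4s + 4. -/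
theorem thetaTerm_mul_pow {q : ℂ} (hq0 : q ≠ 0) (e : ℤ) (s t : ℕ) (het : e + 4 * s + 4 = t)
    (k : ℤ) :
    thetaTerm (q ^ e) q k * (q ^ 4) ^ (k ^ 2 + s * k) = thetaTerm (q ^ t) (q ^ 9) k := by
  have h := two_mul_mul_pred_ediv_two k
  rw [thetaTerm, thetaTerm]
  set T := k * (k - 1) / 2
  rw [neg_eq_neg_one_mul, mul_zpow, neg_eq_neg_one_mul (q ^ t), mul_zpow, mul_assoc, mul_assoc,
    mul_assoc]
  congr 1
  rw [← zpow_natCast q 4, ← zpow_natCast q t, ← zpow_natCast q 9]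
  simp only [← zpow_mul, ← zpow_add₀ hq0]
  congr 1
  rw [← het]
  push_cast
  linear_combination (-4) * h

theorem sum_antidiagonal_mul_of_eq_zero {u : ℕ → ℂ} (hu : ∀ n, u (n + 2) = 0) (g : ℕ → ℂ) (n : ℕ) :
    ∑ p ∈ Finset.HasAntidiagonal.antidiagonal (n + 1), g p.1 * u p.2
      = g (n + 1) * u 0 + g n * u 1 := by
  rw [← Finset.Nat.sum_antidiagonal_swap, Finset.Nat.sum_antidiagonal_eq_sum_range_succ_mk,
    Finset.sum_range_succ', Finset.sum_range_succ', Finset.sum_eq_zero]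
  · simp [add_comm]
  · intro i _
    simp [hu]

/-- The double series obtained from a theta series whose Bailey partner `u` in base `q` is
supported on `{0, 1}`. -/
theorem hasSum_double_series {q : ℂ} (hq : ‖q‖ < 1) (hq0 : q ≠ 0) (e : ℤ) {s t : ℕ} (hs : s ≤ 1)
    (ht1 : 1 ≤ t) (ht8 : t ≤ 8) (het : e + 4 * s + 4 = t) {u : ℕ → ℂ}
    (hu : ∀ n, u n = qPoch (q ^ e) q n * qPoch (q / q ^ e) q (n + s) * invQFac q (2 * n + s : ℕ))
    (hu0 : ∀ n, u (n + 2) = 0) :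
    HasSum (fun p : ℕ × ℕ => (q ^ 4) ^ ((p.1 + p.2) ^ 2 + s * (p.1 + p.2))
        * (qPoch (-q ^ 2) (q ^ 2) (2 * (p.1 + p.2) + s))⁻¹
        * ((-1) ^ p.1 * (q ^ 2) ^ (p.1 ^ 2) * invQFac (q ^ 4) p.1
          * ((qPoch (-q) q (2 * p.2 + s))⁻¹ *
            ∑ i ∈ Finset.HasAntidiagonal.antidiagonal p.2,
              (-1) ^ i.1 * q ^ (i.1 ^ 2) * invQFac (q ^ 2) i.1 * u i.2)))
      (qPochInf₃ (q ^ t) (q ^ 9 / q ^ t) (q ^ 9) (q ^ 9) / qPochInf (q ^ 4) (q ^ 4)) := by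
  obtain ⟨C₁, hC₁0, hC₁⟩ := exists_norm_inv_qPoch_le (a := -q) (by simpa using hq) hq
  obtain ⟨C₂, hC₂0, hC₂⟩ := exists_norm_invQFac_le (norm_pow_lt_one hq two_ne_zero)
  have hg : ∀ n : ℕ, ‖(-1 : ℂ) ^ n * q ^ (n ^ 2) * invQFac (q ^ 2) n‖ ≤ C₂ := by
    intro n
    rw [norm_mul, norm_mul, norm_pow, norm_pow, norm_neg, norm_one, one_pow, one_mul]
    exact (mul_le_mul (pow_le_one₀ (norm_nonneg _) hq.le) (hC₂ _) (norm_nonneg _)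
      zero_le_one).trans_eq (one_mul _)
  have hu' : ∀ n : ℕ, HasSum (fun k : ℤ => thetaTerm (q ^ e) q k
      * (invQFac q (n - k) * invQFac q (n + k + s))) (u n) := by
    intro n
    refine (hasSum_thetaTerm_mul_invQFac hq hq0 (zpow_ne_zero e hq0) n (n + s)).of_eq
      (fun k => ?_) ?_
    · rw [show (n + k + s : ℤ) = (n + s : ℕ) + k by push_cast; ring]
    · rw [hu, ← Nat.cast_add, show n + (n + s) = 2 * n + s by ring]
  have hv := hasSum_base_change hq hq0 s hs hu'
  have hle : ∀ n : ℕ, ‖(qPoch (-q) q (2 * n + s))⁻¹ *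
      ∑ i ∈ Finset.HasAntidiagonal.antidiagonal n,
        (-1) ^ i.1 * q ^ (i.1 ^ 2) * invQFac (q ^ 2) i.1 * u i.2‖
      ≤ C₁ * (C₂ * ‖u 0‖ + C₂ * ‖u 1‖) := by
    intro n
    rw [norm_mul]
    refine mul_le_mul (hC₁ _) ?_ (norm_nonneg _) hC₁0
    cases n with
    | zero =>
      have := mul_le_mul_of_nonneg_right (hg 0) (norm_nonneg (u 0))
      have h1 : 0 ≤ C₂ * ‖u 1‖ := by positivity
      rw [Finset.Nat.antidiagonal_zero, Finset.sum_singleton, norm_mul]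
      linarith
    | succ n =>
      rw [sum_antidiagonal_mul_of_eq_zero hu0
        (fun n : ℕ => (-1) ^ n * q ^ (n ^ 2) * invQFac (q ^ 2) n)]
      refine (norm_add_le _ _).trans ?_
      rw [norm_mul _ (u 0), norm_mul _ (u 1)]
      exact add_le_add (mul_le_mul_of_nonneg_right (hg _) (norm_nonneg _))
        (mul_le_mul_of_nonneg_right (hg _) (norm_nonneg _))
  have hmain := hasSum_double_of_bailey hq hq0 (pow_ne_zero t hq0) hs hv hle
    (thetaTerm_mul_pow hq0 e s t het) (summable_norm_thetaTerm_pow hq hq0 ht1 ht8)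
  exact hmain

/-! ### Evaluating the products and the partners -/

/-- Splits the factors by residue modulo 3; in the limit the triple product for t = 3 collapses to
(q³;q³)_∞. -/
theorem qPoch_three_mul (q : ℂ) (n : ℕ) :
    qPoch (q ^ 3) (q ^ 3) (3 * n)
      = qPoch (q ^ 3) (q ^ 9) n * qPoch (q ^ 6) (q ^ 9) n * qPoch (q ^ 9) (q ^ 9) n := by
  induction n with
  | zero => simp [qPoch_zero]
  | succ n ih =>
    rw [show 3 * (n + 1) = 3 * n + 1 + 1 + 1 by ring]
    simp only [qPoch_succ, ih]
    ring

theorem qPochInf_cube {q : ℂ} (hq : ‖q‖ < 1) :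
    qPochInf (q ^ 3) (q ^ 3) = qPochInf₃ (q ^ 3) (q ^ 6) (q ^ 9) (q ^ 9) := by
  have hq3 : ‖q ^ 3‖ < 1 := norm_pow_lt_one hq (by lia)
  have hq9 : ‖q ^ 9‖ < 1 := norm_pow_lt_one hq (by lia)
  have h1 := (tendsto_qPoch (q ^ 3) hq3).comp
    (tendsto_id.const_mul_atTop' (show 0 < 3 by lia))
  refine tendsto_nhds_unique (h1.congr fun n => qPoch_three_mul q n) ?_
  exact ((tendsto_qPoch _ hq9).mul (tendsto_qPoch _ hq9)).mul (tendsto_qPoch _ hq9)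

theorem qPoch_one_succ (q : ℂ) (n : ℕ) : qPoch 1 q (n + 1) = 0 :=
  Finset.prod_eq_zero (i := 0) (by simp) (by simp)

theorem qPoch_inv_add_two {q : ℂ} (hq0 : q ≠ 0) (n : ℕ) : qPoch q⁻¹ q (n + 2) = 0 :=
  Finset.prod_eq_zero (i := 1) (by simp) (by simp [hq0])

theorem one_add_pow_ne_zero {q : ℂ} (hq : ‖q‖ < 1) {n : ℕ} (hn : n ≠ 0) : 1 + q ^ n ≠ 0 := by
  have := one_sub_mul_pow_ne_zero (a := -q ^ n) (by simpa using norm_pow_lt_one hq hn) hq 0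
  simpa using this

theorem qPochInf_zero_left (q : ℂ) : qPochInf 0 q = 1 := by simp [qPochInf]

/-- The Bailey partner, in base `q`, of the theta series with general term
`thetaTerm (q ^ e) q`. -/
noncomputable def thetaPartner (q : ℂ) (e : ℤ) (s n : ℕ) : ℂ :=
  qPoch (q ^ e) q n * qPoch (q / q ^ e) q (n + s) * invQFac q (2 * n + s : ℕ)

theorem thetaPartner_zero_succ (q : ℂ) (s n : ℕ) : thetaPartner q 0 s (n + 1) = 0 := by
  simp [thetaPartner, qPoch_one_succ]

theorem thetaPartner_neg_one_add_two {q : ℂ} (hq0 : q ≠ 0) (s n : ℕ) :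
    thetaPartner q (-1) s (n + 2) = 0 := by
  rw [thetaPartner, zpow_neg_one, qPoch_inv_add_two hq0, zero_mul, zero_mul]

/-- Since (q²;q)_{1+s} / (q;q)_{2+s} = 1/(1 - q), the value (1 - q⁻¹)/(1 - q) does not depend on s.
-/
theorem thetaPartner_neg_one_one {q : ℂ} (hq : ‖q‖ < 1) (hq0 : q ≠ 0) {s : ℕ} (hs : s ≤ 1) :
    thetaPartner q (-1) s 1 = -q⁻¹ := by
  have h1 : 1 - q ≠ 0 := by simpa using one_sub_pow_ne_zero hq one_ne_zero
  have h2 : 1 - q * q ≠ 0 := by simpa [sq] using one_sub_pow_ne_zero hq two_ne_zero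
  have h3 : 1 - q * q ^ 2 ≠ 0 := by simpa [← pow_succ'] using one_sub_pow_ne_zero hq three_ne_zero
  have h4 := one_sub_pow_ne_zero hq two_ne_zero
  have h5 := one_sub_pow_ne_zero hq three_ne_zero
  rw [thetaPartner, invQFac_natCast]
  interval_cases s
  · simp [qPoch_succ, qPoch_zero]
    field_simp
    ring
  · simp [qPoch_succ, qPoch_zero]
    field_simp
    ring

theorem sum_antidiagonal_one_term {q : ℂ} {u : ℕ → ℂ} (hu0 : ∀ n, u (n + 1) = 0) (hu1 : u 0 = 1)
    (r : ℕ) :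
    ∑ i ∈ Finset.HasAntidiagonal.antidiagonal r,
        (-1 : ℂ) ^ i.1 * q ^ (i.1 ^ 2) * invQFac (q ^ 2) i.1 * u i.2
      = (-1) ^ r * q ^ (r ^ 2) * invQFac (q ^ 2) r := by
  cases r with
  | zero => rw [Finset.Nat.antidiagonal_zero, Finset.sum_singleton]; simp [hu1]
  | succ r =>
    rw [sum_antidiagonal_mul_of_eq_zero (fun n => hu0 (n + 1))
      (fun n : ℕ => (-1) ^ n * q ^ (n ^ 2) * invQFac (q ^ 2) n), hu1, hu0]
    simp

/-- The inner sum when the Bailey partner takes the values `c` and `-q⁻¹`. -/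
theorem sum_antidiagonal_two_term {q : ℂ} (hq : ‖q‖ < 1) (hq0 : q ≠ 0) {u : ℕ → ℂ}
    (hu0 : ∀ n, u (n + 2) = 0) (hu1 : u 1 = -q⁻¹) (r : ℕ) :
    ∑ i ∈ Finset.HasAntidiagonal.antidiagonal r,
        (-1 : ℂ) ^ i.1 * q ^ (i.1 ^ 2) * invQFac (q ^ 2) i.1 * u i.2
      = (-1) ^ r * (q ^ (5 * r ^ 2 - 2 * r) / q ^ (4 * r ^ 2)) * invQFac (q ^ 2) r
        * (1 + (u 0 - 1) * q ^ (2 * r)) := by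
  -- The quotient of powers is q^{r² - 2r}, written with natural exponents since r² - 2r = -1 at r =
  -- 1. It arises from q^{(r-1)²} · q⁻¹ in the second term.
  cases r with
  | zero => rw [Finset.Nat.antidiagonal_zero, Finset.sum_singleton]; simp
  | succ r =>
    rw [sum_antidiagonal_mul_of_eq_zero hu0
      (fun n : ℕ => (-1) ^ n * q ^ (n ^ 2) * invQFac (q ^ 2) n), hu1]
    have e : invQFac (q ^ 2) r = (1 - (q ^ 2) ^ (r + 1)) * invQFac (q ^ 2) (r + 1 : ℕ) := by
      rw [← zpow_natCast (q ^ 2), ← invQFac_sub_one (norm_pow_lt_one hq two_ne_zero)]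
      congr 1; push_cast; ring
    have e2 : 5 * (r + 1) ^ 2 - 2 * (r + 1) = 5 * r ^ 2 + 8 * r + 3 :=
      Nat.sub_eq_of_eq_add (by ring)
    rw [e2]
    rw [e]
    field_simp
    ring

/-! ### The four identities for q ≠ 0 -/

theorem hasSum_double_series_exponent_eight {q : ℂ} (hq : ‖q‖ < 1) (hq0 : q ≠ 0) :
    HasSum
      (fun p : ℕ × ℕ =>
        (-1 : ℂ) ^ (p.1 + p.2)
            * q ^ (6 * p.1 ^ 2 + 8 * p.1 * p.2 + 5 * p.2 ^ 2 + 4 * p.1 + 4 * p.2)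
          / (qPoch (-q ^ 2) (q ^ 2) (2 * p.1 + 2 * p.2 + 1) * qPoch (q ^ 2) (q ^ 2) p.2
              * qPoch (-q) q (2 * p.2 + 1) * qPoch (q ^ 4) (q ^ 4) p.1))
      (qPochInf₃ q (q ^ 8) (q ^ 9) (q ^ 9) / qPochInf (q ^ 4) (q ^ 4)) := by
  have h1 : 1 - q ≠ 0 := by simpa using one_sub_pow_ne_zero hq one_ne_zero
  have hu : thetaPartner q 0 1 0 = 1 := by
    rw [thetaPartner, invQFac_natCast]
    simp [qPoch_succ, qPoch_zero, h1]
  refine (hasSum_double_series hq hq0 0 (s := 1) (t := 8) le_rfl (by lia) le_rfl (by norm_num)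
    (u := thetaPartner q 0 1) (fun _ => rfl)
    (fun n => thetaPartner_zero_succ q 1 (n + 1))).of_eq (fun p => ?_) ?_
  · rw [sum_antidiagonal_one_term (thetaPartner_zero_succ q 1) hu]
    simp only [invQFac_natCast, mul_add, div_eq_mul_inv, mul_inv]
    ring
  · rw [show q ^ 9 / q ^ 8 = q by field_simp, qPochInf₃, qPochInf₃]
    ring

theorem hasSum_double_series_exponent_four {q : ℂ} (hq : ‖q‖ < 1) (hq0 : q ≠ 0) :
    HasSum
      (fun p : ℕ × ℕ =>
        (-1 : ℂ) ^ (p.1 + p.2)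
            * q ^ (6 * p.1 ^ 2 + 8 * p.1 * p.2 + 5 * p.2 ^ 2)
          / (qPoch (-q ^ 2) (q ^ 2) (2 * p.1 + 2 * p.2) * qPoch (q ^ 2) (q ^ 2) p.2
              * qPoch (-q) q (2 * p.2) * qPoch (q ^ 4) (q ^ 4) p.1))
      (qPochInf₃ (q ^ 4) (q ^ 5) (q ^ 9) (q ^ 9) / qPochInf (q ^ 4) (q ^ 4)) := by
  have hu : thetaPartner q 0 0 0 = 1 := by simp [thetaPartner, invQFac_zero, qPoch_zero]
  refine (hasSum_double_series hq hq0 0 (s := 0) (t := 4) zero_le_one (by lia) (by lia)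
    (by norm_num) (u := thetaPartner q 0 0) (fun _ => rfl)
    (fun n => thetaPartner_zero_succ q 0 (n + 1))).of_eq (fun p => ?_) ?_
  · rw [sum_antidiagonal_one_term (thetaPartner_zero_succ q 0) hu]
    simp only [invQFac_natCast, mul_add, add_zero, div_eq_mul_inv, mul_inv]
    ring
  · rw [show q ^ 9 / q ^ 4 = q ^ 5 by field_simp]

theorem hasSum_double_series_exponent_three {q : ℂ} (hq : ‖q‖ < 1) (hq0 : q ≠ 0) :
    HasSum
      (fun p : ℕ × ℕ =>
        (-1 : ℂ) ^ (p.1 + p.2)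
            * q ^ (6 * p.1 ^ 2 + 8 * p.1 * p.2 + 5 * p.2 ^ 2 - 2 * p.2)
          / (qPoch (-q ^ 2) (q ^ 2) (2 * p.1 + 2 * p.2) * qPoch (q ^ 2) (q ^ 2) p.2
              * qPoch (-q) q (2 * p.2) * qPoch (q ^ 4) (q ^ 4) p.1))
      (qPochInf (q ^ 3) (q ^ 3) / qPochInf (q ^ 4) (q ^ 4)) := by
  have hu : thetaPartner q (-1) 0 0 = 1 := by simp [thetaPartner, invQFac_zero, qPoch_zero]
  refine (hasSum_double_series hq hq0 (-1) (s := 0) (t := 3) zero_le_one (by lia) (by lia)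
    (by norm_num) (u := thetaPartner q (-1) 0) (fun _ => rfl)
    (thetaPartner_neg_one_add_two hq0 0)).of_eq (fun p => ?_) ?_
  · obtain ⟨n, r⟩ := p
    rw [sum_antidiagonal_two_term hq hq0 (thetaPartner_neg_one_add_two hq0 0)
      (thetaPartner_neg_one_one hq hq0 zero_le_one), hu]
    obtain ⟨m, hm⟩ : ∃ m, 5 * r ^ 2 = 2 * r + m :=
      Nat.exists_eq_add_of_le (by nlinarith [Nat.le_self_pow two_ne_zero r])
    have hm' : 6 * n ^ 2 + 8 * n * r + 5 * r ^ 2 - 2 * r = 6 * n ^ 2 + 8 * n * r + m := by lia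
    rw [hm']
    simp only [hm, Nat.add_sub_cancel_left, invQFac_natCast, sub_self, zero_mul,
      add_zero]
    have e : (q ^ 4) ^ ((n + r) ^ 2) * (q ^ (4 * r ^ 2))⁻¹ = q ^ (4 * n ^ 2 + 8 * n * r) := by
      rw [← div_eq_mul_inv, div_eq_iff (pow_ne_zero _ hq0)]; ring
    have e' : q ^ (6 * n ^ 2 + 8 * n * r + m)
        = (q ^ 2) ^ n ^ 2 * q ^ (4 * n ^ 2 + 8 * n * r) * q ^ m := by ring
    rw [e', ← e, ← mul_add 2 n r]
    simp only [div_eq_mul_inv, mul_inv, pow_add (-1 : ℂ)]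
    ring
  · rw [show q ^ 9 / q ^ 3 = q ^ 6 by field_simp, qPochInf_cube hq]

theorem hasSum_double_series_exponent_seven {q : ℂ} (hq : ‖q‖ < 1) (hq0 : q ≠ 0) :
    HasSum
      (fun p : ℕ × ℕ =>
        (-1 : ℂ) ^ (p.1 + p.2)
            * q ^ (6 * p.1 ^ 2 + 8 * p.1 * p.2 + 5 * p.2 ^ 2 + 4 * p.1 + 2 * p.2)
          / (qPoch (-q ^ 2) (q ^ 2) (2 * p.1 + 2 * p.2 + 1) * qPoch (q ^ 2) (q ^ 2) p.2
              * qPoch (-q) q (2 * p.2) * qPoch (q ^ 4) (q ^ 4) p.1))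
      (qPochInf₃ (q ^ 2) (q ^ 7) (q ^ 9) (q ^ 9) / qPochInf (q ^ 4) (q ^ 4)) := by
  have hu : thetaPartner q (-1) 1 0 = 1 + q := by
    have h1 : 1 - q ≠ 0 := by simpa using one_sub_pow_ne_zero hq one_ne_zero
    rw [thetaPartner, invQFac_natCast]
    simp [qPoch_succ, qPoch_zero]
    field_simp
    ring
  refine (hasSum_double_series hq hq0 (-1) (s := 1) (t := 7) le_rfl (by lia) (by lia)
    (by norm_num) (u := thetaPartner q (-1) 1) (fun _ => rfl)
    (thetaPartner_neg_one_add_two hq0 1)).of_eq (fun p => ?_) ?_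
  · obtain ⟨n, r⟩ := p
    rw [sum_antidiagonal_two_term hq hq0 (thetaPartner_neg_one_add_two hq0 1)
      (thetaPartner_neg_one_one hq hq0 le_rfl), hu, qPoch_neg_succ q (2 * r)]
    obtain ⟨m, hm⟩ : ∃ m, 5 * r ^ 2 = 2 * r + m :=
      Nat.exists_eq_add_of_le (by nlinarith [Nat.le_self_pow two_ne_zero r])
    have h4 := one_add_pow_ne_zero hq (n := 2 * r + 1) (by lia)
    -- As u(0) = 1 + q, the two-term inner sum carries the factor 1 + q^{2r+1}, which cancels the
    -- last factor of (-q;q)_{2r+1} and leaves (-q;q)_{2r}.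
    have h5 : (1 + q ^ (2 * r + 1))⁻¹ * (1 + (1 + q - 1) * q ^ (2 * r)) = 1 := by
      rw [show 1 + (1 + q - 1) * q ^ (2 * r) = 1 + q ^ (2 * r + 1) by ring, inv_mul_cancel₀ h4]
    have e : (q ^ 4) ^ ((n + r) ^ 2 + 1 * (n + r)) * (q ^ (4 * r ^ 2))⁻¹
        = q ^ (4 * n ^ 2 + 8 * n * r + 4 * n + 4 * r) := by
      rw [← div_eq_mul_inv, div_eq_iff (pow_ne_zero _ hq0)]; ring
    have e' : q ^ (6 * n ^ 2 + 8 * n * r + 5 * r ^ 2 + 4 * n + 2 * r)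
        = (q ^ 2) ^ n ^ 2 * q ^ (4 * n ^ 2 + 8 * n * r + 4 * n + 4 * r) * q ^ m := by
      rw [hm]; ring
    simp only [hm, Nat.add_sub_cancel_left, invQFac_natCast] at e' ⊢
    rw [e', ← e, ← mul_add 2 n r]
    simp only [div_eq_mul_inv, mul_inv, pow_add (-1 : ℂ)]
    generalize (1 + q ^ (2 * r + 1))⁻¹ = X at *
    generalize 1 + (1 + q - 1) * q ^ (2 * r) = Y at *
    linear_combination (-((q ^ 4) ^ ((n + r) ^ 2 + 1 * (n + r)) * (q ^ (4 * r ^ 2))⁻¹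
      * (q ^ 2) ^ n ^ 2 * q ^ m * (-1) ^ n * (-1) ^ r
      * (qPoch (-q ^ 2) (q ^ 2) (2 * (n + r) + 1))⁻¹ * (qPoch (q ^ 2) (q ^ 2) r)⁻¹
      * (qPoch (-q) q (2 * r))⁻¹ * (qPoch (q ^ 4) (q ^ 4) n)⁻¹)) * h5
  · rw [show q ^ 9 / q ^ 7 = q ^ 2 by field_simp, qPochInf₃, qPochInf₃]
    ring

/-! ### The case q = 0 and the conclusion -/

theorem hasSum_of_eq_zero_off {F : ℕ × ℕ → ℂ} {a : ℂ} (h0 : F (0, 0) = a)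
    (h : ∀ n r, n ≠ 0 ∨ r ≠ 0 → F (n, r) = 0) : HasSum F a := by
  rw [← h0]
  refine hasSum_single _ fun p hp => h p.1 p.2 ?_
  by_contra! hc
  exact hp (Prod.ext hc.1 hc.2)

/-- Four Rogers–Ramanujan type identities for `|q| < 1`; each double series over `n, r ≥ 0`
converges unconditionally to the stated quotient of infinite products.  In the third series the
exponent is a natural number since `2 r ≤ 5 r ^ 2`. -/
theorem mainTheorem6 (q : ℂ) (hq : ‖q‖ < 1) :
    HasSum
      (fun p : ℕ × ℕ =>
        (-1 : ℂ) ^ (p.1 + p.2)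
            * q ^ (6 * p.1 ^ 2 + 8 * p.1 * p.2 + 5 * p.2 ^ 2 + 4 * p.1 + 4 * p.2)
          / (qPoch (-q ^ 2) (q ^ 2) (2 * p.1 + 2 * p.2 + 1) * qPoch (q ^ 2) (q ^ 2) p.2
              * qPoch (-q) q (2 * p.2 + 1) * qPoch (q ^ 4) (q ^ 4) p.1))
      (qPochInf₃ q (q ^ 8) (q ^ 9) (q ^ 9) / qPochInf (q ^ 4) (q ^ 4))
    ∧ HasSum
      (fun p : ℕ × ℕ =>
        (-1 : ℂ) ^ (p.1 + p.2)
            * q ^ (6 * p.1 ^ 2 + 8 * p.1 * p.2 + 5 * p.2 ^ 2 + 4 * p.1 + 2 * p.2)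
          / (qPoch (-q ^ 2) (q ^ 2) (2 * p.1 + 2 * p.2 + 1) * qPoch (q ^ 2) (q ^ 2) p.2
              * qPoch (-q) q (2 * p.2) * qPoch (q ^ 4) (q ^ 4) p.1))
      (qPochInf₃ (q ^ 2) (q ^ 7) (q ^ 9) (q ^ 9) / qPochInf (q ^ 4) (q ^ 4))
    ∧ HasSum
      (fun p : ℕ × ℕ =>
        (-1 : ℂ) ^ (p.1 + p.2)
            * q ^ (6 * p.1 ^ 2 + 8 * p.1 * p.2 + 5 * p.2 ^ 2 - 2 * p.2)
          / (qPoch (-q ^ 2) (q ^ 2) (2 * p.1 + 2 * p.2) * qPoch (q ^ 2) (q ^ 2) p.2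
              * qPoch (-q) q (2 * p.2) * qPoch (q ^ 4) (q ^ 4) p.1))
      (qPochInf (q ^ 3) (q ^ 3) / qPochInf (q ^ 4) (q ^ 4))
    ∧ HasSum
      (fun p : ℕ × ℕ =>
        (-1 : ℂ) ^ (p.1 + p.2)
            * q ^ (6 * p.1 ^ 2 + 8 * p.1 * p.2 + 5 * p.2 ^ 2)
          / (qPoch (-q ^ 2) (q ^ 2) (2 * p.1 + 2 * p.2) * qPoch (q ^ 2) (q ^ 2) p.2
              * qPoch (-q) q (2 * p.2) * qPoch (q ^ 4) (q ^ 4) p.1))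
      (qPochInf₃ (q ^ 4) (q ^ 5) (q ^ 9) (q ^ 9) / qPochInf (q ^ 4) (q ^ 4)) := by
  -- The main argument divides by powers of q. At q = 0 only the term n = r = 0 survives, and both
  -- sides equal 1.
  by_cases hq0 : q = 0
  · subst hq0
    refine ⟨hasSum_of_eq_zero_off ?_ fun n r h => ?_, hasSum_of_eq_zero_off ?_ fun n r h => ?_,
      hasSum_of_eq_zero_off ?_ fun n r h => ?_, hasSum_of_eq_zero_off ?_ fun n r h => ?_⟩
    case refine_5 => simp [qPoch, qPochInf_zero_left]
    case refine_6 =>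
      -- Truncated subtraction could hide a zero exponent here; n ≤ n² and r ≤ r² rule it out away
      -- from the origin.
      have : 6 * n ^ 2 + 8 * n * r + 5 * r ^ 2 - 2 * r ≠ 0 := by
        have h1 := Nat.le_self_pow two_ne_zero n
        have h2 := Nat.le_self_pow two_ne_zero r
        have h3 := Nat.zero_le (n * r)
        rw [mul_assoc]
        lia
      simp [zero_pow this]
    all_goals first
      | (rcases h with h | h <;> simp [h])
      | simp [qPoch, qPochInf₃, qPochInf_zero_left]
  · exact ⟨hasSum_double_series_exponent_eight hq hq0, hasSum_double_series_exponent_seven hq hq0,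
      hasSum_double_series_exponent_three hq hq0, hasSum_double_series_exponent_four hq hq0⟩
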